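/- For points of the plane, say that a finite set $X$ is \emph{left of} $Y$ if every point of $X$ has smaller $x$-coordinate than every point of $Y$, and that $X$ is \emph{high above} $Y$ if every line through two distinct points of $X$ is (non-vertical and) strictly above every point of $Y$ and every line through two distinct points of $Y$ is (non-vertical and) strictly below every point of $X$. Given integers $\delta_{k,l},\delta'_{k,l}$, define sets $S_{k,l}$ recursively by $S_{k,l}=\{(0,0)\}$ if $k\le 2$ or $l\le 2$, and otherwise $S_{k,l}=L_{k,l}\cup R_{k,l}$ with $L_{k,l}=S_{k-1,l}$ and $R_{k,l}=S_{k,l-1}+(\delta_{k,l},\delta'_{k,l})$. The numbers $\delta_{k,l},\delta'_{k,l}$ are \emph{admissible} if, for all $k,l\ge 3$, $L_{k,l}$ is left of $R_{k,l}$ and $R_{k,l}$ is high above $L_{k,l}$. For an integer $t\ge 2$, an \emph{integer realization of the Erdős–Szekeres construction} with parameter $t$ is a set $S=B_0\cup B_1\cup\dots\cup B_{t-2}\subset\mathbb Z^2$ where, for some admissible integers $\delta_{k,l},\delta'_{k,l}$, each $B_i$ is a translate of $S_{t-i,i+2}$ by an integer vector, and where (i) for $i<j$, $B_i$ is left of $B_j$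 and high above $B_j$; (ii) for $i<j<k$ and $a\in B_i$, $b\in B_j$, $c\in B_k$, the triple $(a,b,c)$ is a right turn. \textbf{Theorem.} There is a function $m:\mathbb N\to\mathbb N$ such that, with $n=2^{t-2}$, $$m(t)=O\bigl(n^2\log_2(n)^3\bigr)\qquad (t\to\infty),$$ and such that for every integer $t\ge 2$ there is an integer realization $S$ of the Erdős–Szekeres construction with parameter $t$ with the following properties: $S$ has exactly $n=2^{t-2}$ points; no three distinct points of $S$ are collinear; every subset of $S$ that is the vertex set of a convex polygon (that is, in which no point lies in the convex hull of the others) has at most $t-1=\log_2(n)+1$ points; and $S$ is contained in the $m(t)\times m(t)$ integer grid $\{1,\dots,m(t)\}^2$. -/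

import Mathlib

open Filter Asymptotics

namespace ErdosSzekeres

/-- Twice the signed area of the triangle `p q a`. It is positive if `(p, q, a)` is a left turn,
negative if it is a right turn, and zero if the three points are collinear. -/
def orient (p q a : ℤ × ℤ) : ℤ :=
  (q.1 - p.1) * (a.2 - p.2) - (q.2 - p.2) * (a.1 - p.1)

/-- The (non-vertical) line through `p` and `q` is strictly above the point `a`. -/
def LineAbove (p q a : ℤ × ℤ) : Prop :=
  (p.1 < q.1 ∧ orient p q a < 0) ∨ (q.1 < p.1 ∧ orient q p a < 0)

/-- The (non-vertical) line through `p` and `q` is strictly below the point `a`. -/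
def LineBelow (p q a : ℤ × ℤ) : Prop :=
  (p.1 < q.1 ∧ 0 < orient p q a) ∨ (q.1 < p.1 ∧ 0 < orient q p a)

/-- `X` is high above `Y`: every line determined by two points of `X` is above every point of `Y`,
and every line determined by two points of `Y` is below every point of `X`. -/
def HighAbove (X Y : Finset (ℤ × ℤ)) : Prop :=
  (∀ p ∈ X, ∀ q ∈ X, p ≠ q → ∀ a ∈ Y, LineAbove p q a) ∧
  (∀ p ∈ Y, ∀ q ∈ Y, p ≠ q → ∀ a ∈ X, LineBelow p q a)

/-- Every point of `X` is to the left of every point of `Y`. -/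
def LeftOf (X Y : Finset (ℤ × ℤ)) : Prop :=
  ∀ p ∈ X, ∀ q ∈ Y, p.1 < q.1

/-- The translate of `X` by the vector `v`. -/
def translate (v : ℤ × ℤ) (X : Finset (ℤ × ℤ)) : Finset (ℤ × ℤ) :=
  X.image fun p => (p.1 + v.1, p.2 + v.2)

/-- The point set `S_{k,l}` built with the displacements `(δ k l, δ' k l)`:
a single point at the origin if `k ≤ 2` or `l ≤ 2`, and otherwise the union of `S_{k-1,l}` and of
the translate of `S_{k,l-1}` by `(δ k l, δ' k l)`. -/
def cupCapSet (δ δ' : ℕ → ℕ → ℤ) (k l : ℕ) : Finset (ℤ × ℤ) :=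
  if k ≤ 2 ∨ l ≤ 2 then {(0, 0)}
  else cupCapSet δ δ' (k - 1) l ∪ translate (δ k l, δ' k l) (cupCapSet δ δ' k (l - 1))
termination_by k + l

/-- The displacements are chosen as the construction of the sets `S_{k,l}` requires: the right part
of `S_{k,l}` is to the right of its left part, and high above it. -/
def Admissible (δ δ' : ℕ → ℕ → ℤ) : Prop :=
  ∀ k l : ℕ, 3 ≤ k → 3 ≤ l →
    LeftOf (cupCapSet δ δ' (k - 1) l)
      (translate (δ k l, δ' k l) (cupCapSet δ δ' k (l - 1))) ∧
    HighAbove (translate (δ k l, δ' k l) (cupCapSet δ δ' k (l - 1)))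
      (cupCapSet δ δ' (k - 1) l)

/-- `S` is a realization with integer coordinates of the Erdős–Szekeres construction with
parameter `t`: it is the union of blocks `B 0, …, B (t - 2)`, where `B i` is a translate of
`S_{t-i,i+2}`, and the blocks are arranged from left to right so that each block is high above all
later blocks, and any three points of three different blocks, taken in the order of the blocks,
form a right turn.  These conditions determine the orientation of every triple of points. -/
def IsErdosSzekeresConstruction (t : ℕ) (S : Finset (ℤ × ℤ)) : Prop :=
  ∃ (δ δ' : ℕ → ℕ → ℤ) (q : ℕ → ℤ × ℤ) (B : ℕ → Finset (ℤ × ℤ)),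
    Admissible δ δ' ∧
    (∀ i, i ≤ t - 2 → B i = translate (q i) (cupCapSet δ δ' (t - i) (i + 2))) ∧
    S = (Finset.range (t - 1)).biUnion B ∧
    (∀ i j, i < j → j ≤ t - 2 → LeftOf (B i) (B j) ∧ HighAbove (B i) (B j)) ∧
    (∀ i j k, i < j → j < k → k ≤ t - 2 →
      ∀ a ∈ B i, ∀ b ∈ B j, ∀ c ∈ B k, orient a b c < 0)

/-- An integer point as a point of the real plane. -/
def toPlane (p : ℤ × ℤ) : ℝ × ℝ := ((p.1 : ℝ), (p.2 : ℝ))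

/-- No three distinct points of `S` are collinear. -/
def GeneralPosition (S : Finset (ℤ × ℤ)) : Prop :=
  ∀ a ∈ S, ∀ b ∈ S, ∀ c ∈ S, a ≠ b → a ≠ c → b ≠ c →
    ¬ Collinear ℝ {toPlane a, toPlane b, toPlane c}

/-- `T` is the vertex set of a convex polygon: no point of `T` lies in the convex hull of the
other points of `T`. -/
def IsConvexPolygon (T : Finset (ℤ × ℤ)) : Prop :=
  ConvexIndependent ℝ (fun p : T => toPlane p)

/-- `S` lies in the `m × m` integer grid `{1, …, m} × {1, …, m}`. -/
def LiesInGrid (m : ℕ) (S : Finset (ℤ × ℤ)) : Prop :=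
  ∀ p ∈ S, 1 ≤ p.1 ∧ p.1 ≤ m ∧ 1 ≤ p.2 ∧ p.2 ≤ m

end ErdosSzekeres

/-!
For displacements we take `δ_{k,l} = 4 ^ M` and `δ'_{k,l} = M 4 ^ M` with `M = k + l - 6`. Since they
depend on `k + l` only, `S_{k,l}` is contained in the set `stepSums (M + 1)` of all sums of subsets
of `{(4 ^ j, j 4 ^ j) | j ≤ M}`, and being high above passes to subsets, so it suffices to compare
`stepSums M` with its translate by `(4 ^ M, M 4 ^ M)`. The slope `M - 1/3` separates the lines inside
these two sets, which are less steep (`stepSums_slope`), from the lines joining one set to the other,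
which are steeper (`stepSums_cross`); this is `admissible_disp`. The base four is exactly what makes
the two geometric series behind these bounds meet, see `stepSums_sub_bounds`.

For the union of the blocks, let `W = 4 ^ (t - 3)`. Each block has width at most `W`, height at most
`t W`, and slopes at least `-1`. The blocks are put along a descending parabola at horizontal
distances `4 t W`. Lines between blocks then have slope less than `-1`, so earlier blocks are high
above later ones. The slopes of the parabola are `O(t)`; the widths of the blocks change them by a
factor `1 + O(1 / t)`, and the heights of the blocks by `O(1)`, and the constants are such that this
cannot destroy the concavity of the parabola (`parabola_right_turn`). The construction has width `O(t ^ 2 W)` and height `O(t ^ 3 W)`,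
where `W ≤ n ^ 2` and `t = log₂ n + 2`.

The number of points and the bounds on convex polygons hold for every realization. If `X` is high
above `Y`, a convex polygon that meets both has a cap in `X` and a cup in `Y`, because otherwise one
of its vertices would lie in a triangle spanned by three others (`IsConvexPolygon.isCap_inter`,
`IsConvexPolygon.isCup_inter`). By induction `S_{k,l}` has cups of at most `k - 1` points, caps of at
most `l - 1` points, and convex polygons of at most `k + l - 3` points. A convex polygon that meets
several blocks, `B_i` being the first and `B_j` the last, has a cap in `B_i`, a cup in `B_j` and at
most one point in each block between, so at most `(i + 1) + (j - i - 1) + (t - j - 1) = t - 1` points.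
-/

namespace ErdosSzekeres

/-! ### Orientations -/

lemma orient_swap (p q a : ℤ × ℤ) : orient q p a = -orient p q a := by
  unfold orient; ring

lemma orient_rotate (p q a : ℤ × ℤ) : orient q a p = orient p q a := by
  unfold orient; ring

lemma LineAbove.orient_ne_zero {p q a : ℤ × ℤ} (h : LineAbove p q a) : orient p q a ≠ 0 := by
  rcases h with ⟨_, h⟩ | ⟨_, h⟩
  · exact h.ne
  · rw [orient_swap] at h; omega

lemma LineBelow.orient_ne_zero {p q a : ℤ × ℤ} (h : LineBelow p q a) : orient p q a ≠ 0 := by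
  rcases h with ⟨_, h⟩ | ⟨_, h⟩
  · exact h.ne'
  · rw [orient_swap] at h; omega

lemma LineAbove.orient_neg {p q a : ℤ × ℤ} (h : LineAbove p q a) (hpq : p.1 < q.1) :
    orient p q a < 0 := by
  rcases h with ⟨_, h⟩ | ⟨h, _⟩
  · exact h
  · omega

lemma LineBelow.orient_pos {p q a : ℤ × ℤ} (h : LineBelow p q a) (hpq : p.1 < q.1) :
    0 < orient p q a := by
  rcases h with ⟨_, h⟩ | ⟨h, _⟩
  · exact h
  · omega

lemma orient_eq_zero_of_collinear {a b c : ℤ × ℤ}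
    (h : Collinear ℝ {toPlane a, toPlane b, toPlane c}) : orient a b c = 0 := by
  obtain ⟨v, hv⟩ := (collinear_iff_of_mem (p₀ := toPlane a) (by simp)).1 h
  obtain ⟨r, hr⟩ := hv (toPlane b) (by simp)
  obtain ⟨s, hs⟩ := hv (toPlane c) (by simp)
  have hr1 := congrArg Prod.fst hr
  have hr2 := congrArg Prod.snd hr
  have hs1 := congrArg Prod.fst hs
  have hs2 := congrArg Prod.snd hs
  simp only [toPlane, vadd_eq_add, Prod.fst_add, Prod.snd_add, Prod.smul_fst, Prod.smul_snd,
    smul_eq_mul] at hr1 hr2 hs1 hs2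
  have : ((orient a b c : ℤ) : ℝ) = 0 := by
    simp only [orient, Int.cast_sub, Int.cast_mul, hr1, hr2, hs1, hs2]
    ring
  exact_mod_cast this

/-- A point of a closed nondegenerate triangle cannot be a vertex of a convex polygon that also has
the three corners as vertices. -/
lemma IsConvexPolygon.not_mem_triangle {T : Finset (ℤ × ℤ)} (hT : IsConvexPolygon T)
    {a b c p : ℤ × ℤ} (ha : a ∈ T) (hb : b ∈ T) (hc : c ∈ T) (hp : p ∈ T)
    (hpa : p ≠ a) (hpb : p ≠ b) (hpc : p ≠ c)
    (h1 : 0 ≤ orient a b p) (h2 : 0 ≤ orient b c p) (h3 : 0 ≤ orient c a p) :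
    orient a b c ≤ 0 := by
  by_contra! h0
  have hmem : toPlane p ∈ convexHull ℝ ((fun p : T => toPlane p) ''
      {⟨a, ha⟩, ⟨b, hb⟩, ⟨c, hc⟩}) := by
    simp only [Set.image_insert_eq, Set.image_singleton]
    have h0' : (0 : ℝ) < orient a b c := by exact_mod_cast h0
    have h1' : (0 : ℝ) ≤ orient a b p := by exact_mod_cast h1
    have h2' : (0 : ℝ) ≤ orient b c p := by exact_mod_cast h2
    have h3' : (0 : ℝ) ≤ orient c a p := by exact_mod_cast h3
    have hconv := convex_convexHull ℝ ({toPlane a, toPlane b, toPlane c} : Set (ℝ × ℝ))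
    -- the barycentric coordinates of `p` are ratios of signed areas
    have key := hconv.sum_mem (t := Finset.univ)
      (w := ![(orient b c p : ℝ) / orient a b c, (orient c a p : ℝ) / orient a b c,
        (orient a b p : ℝ) / orient a b c]) (z := ![toPlane a, toPlane b, toPlane c])
      (by
        intro i _
        fin_cases i
        · exact div_nonneg h2' h0'.le
        · exact div_nonneg h3' h0'.le
        · exact div_nonneg h1' h0'.le)
      (by
        simp only [Fin.sum_univ_three, Matrix.cons_val]
        field_simp
        simp only [orient]; push_cast; ring)
      (by
        intro i _
        fin_cases i <;> exact subset_convexHull ℝ _ (by simp))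
    have e : ∑ i, (![(orient b c p : ℝ) / orient a b c, (orient c a p : ℝ) / orient a b c,
        (orient a b p : ℝ) / orient a b c] i) • (![toPlane a, toPlane b, toPlane c] i)
        = toPlane p := by
      simp only [Fin.sum_univ_three, Matrix.cons_val]
      apply Prod.ext
      · simp only [toPlane, Prod.fst_add, Prod.smul_fst, smul_eq_mul]
        field_simp
        simp only [orient]; push_cast; ring
      · simp only [toPlane, Prod.snd_add, Prod.smul_snd, smul_eq_mul]
        field_simp
        simp only [orient]; push_cast; ring
    rwa [e] at key
  have := hT _ ⟨p, hp⟩ hmem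
  simp [Subtype.ext_iff, hpa, hpb, hpc] at this

lemma IsConvexPolygon.subset {T U : Finset (ℤ × ℤ)} (hT : IsConvexPolygon T) (h : U ⊆ T) :
    IsConvexPolygon U :=
  ConvexIndependent.comp_embedding (f := ⟨fun p : U => (⟨p.1, h p.2⟩ : T), fun _ _ e =>
    Subtype.ext (Subtype.mk.inj e)⟩) hT

/-! ### Cups and caps -/

/-- `T` is a cup: any three of its points, taken from left to right, form a left turn. -/
def IsCup (T : Finset (ℤ × ℤ)) : Prop :=
  ∀ p ∈ T, ∀ q ∈ T, ∀ r ∈ T, p.1 < q.1 → q.1 < r.1 → 0 < orient p q r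

/-- `T` is a cap: any three of its points, taken from left to right, form a right turn. -/
def IsCap (T : Finset (ℤ × ℤ)) : Prop :=
  ∀ p ∈ T, ∀ q ∈ T, ∀ r ∈ T, p.1 < q.1 → q.1 < r.1 → orient p q r < 0

lemma IsCup.subset {T U : Finset (ℤ × ℤ)} (hT : IsCup T) (h : U ⊆ T) : IsCup U :=
  fun p hp q hq r hr => hT p (h hp) q (h hq) r (h hr)

lemma IsCap.subset {T U : Finset (ℤ × ℤ)} (hT : IsCap T) (h : U ⊆ T) : IsCap U :=
  fun p hp q hq r hr => hT p (h hp) q (h hq) r (h hr)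

/-- If a convex polygon has a vertex `c` below all the lines spanned by `X`, then its vertices in
`X` form a cap: the middle point of a cup in `X` would lie in the triangle spanned by `c` and the
other two points of the cup. -/
lemma IsConvexPolygon.isCap_inter {T X Y : Finset (ℤ × ℤ)} (hT : IsConvexPolygon T)
    (hXY : HighAbove X Y) (hY : (T ∩ Y).Nonempty) : IsCap (T ∩ X) := by
  obtain ⟨c, hc⟩ := hY
  rw [Finset.mem_inter] at hc
  intro p hp q hq r hr hpq hqr
  rw [Finset.mem_inter] at hp hq hr
  by_contra! h
  have ne : ∀ {u v : ℤ × ℤ}, u.1 < v.1 → u ≠ v := fun h e => by simp [e] at h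
  have hpr := hpq.trans hqr
  have h1 := (hXY.1 p hp.2 q hq.2 (ne hpq) c hc.2).orient_neg hpq
  have h2 := (hXY.1 q hq.2 r hr.2 (ne hqr) c hc.2).orient_neg hqr
  have h3 := (hXY.1 p hp.2 r hr.2 (ne hpr) c hc.2).orient_neg hpr
  have hqc : q ≠ c := by
    rintro rfl
    simp [orient] at h2
  have := hT.not_mem_triangle hp.1 hc.1 hr.1 hq.1 (ne hpq).symm hqc (ne hqr)
    (by unfold orient at *; linarith) (by unfold orient at *; linarith)
    (by unfold orient at *; linarith)
  unfold orient at *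
  linarith

/-- If a convex polygon has a vertex above all the lines spanned by `Y`, then its vertices in `Y`
form a cup. -/
lemma IsConvexPolygon.isCup_inter {T X Y : Finset (ℤ × ℤ)} (hT : IsConvexPolygon T)
    (hXY : HighAbove X Y) (hX : (T ∩ X).Nonempty) : IsCup (T ∩ Y) := by
  obtain ⟨c, hc⟩ := hX
  rw [Finset.mem_inter] at hc
  intro p hp q hq r hr hpq hqr
  rw [Finset.mem_inter] at hp hq hr
  by_contra! h
  have ne : ∀ {u v : ℤ × ℤ}, u.1 < v.1 → u ≠ v := fun h e => by simp [e] at h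
  have hpr := hpq.trans hqr
  have h1 := (hXY.2 p hp.2 q hq.2 (ne hpq) c hc.2).orient_pos hpq
  have h2 := (hXY.2 q hq.2 r hr.2 (ne hqr) c hc.2).orient_pos hqr
  have h3 := (hXY.2 p hp.2 r hr.2 (ne hpr) c hc.2).orient_pos hpr
  have hqc : q ≠ c := by
    rintro rfl
    simp [orient] at h2
  have := hT.not_mem_triangle hr.1 hc.1 hp.1 hq.1 (ne hqr) hqc (ne hpq).symm
    (by unfold orient at *; linarith) (by unfold orient at *; linarith)
    (by unfold orient at *; linarith)
  unfold orient at *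
  linarith

/-- A cup that meets both parts has only one point in the upper part. -/
lemma IsCup.card_inter_le_one {T L R : Finset (ℤ × ℤ)} (hT : IsCup T) (hLR : LeftOf L R)
    (hRL : HighAbove R L) (hL : (T ∩ L).Nonempty) : (T ∩ R).card ≤ 1 := by
  obtain ⟨a, ha⟩ := hL
  rw [Finset.mem_inter] at ha
  have key : ∀ p ∈ T ∩ R, ∀ q ∈ T ∩ R, p.1 < q.1 → orient p q a < 0 → False := by
    intro p hp q hq hpq h
    rw [Finset.mem_inter] at hp hq
    have := hT a ha.1 p hp.1 q hq.1 (hLR a ha.2 p hp.2) hpq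
    rw [orient_rotate] at h
    omega
  refine Finset.card_le_one.2 fun p hp q hq => ?_
  by_contra hne
  rcases hRL.1 p (Finset.mem_inter.1 hp).2 q (Finset.mem_inter.1 hq).2 hne a ha.2 with h | h
  · exact key p hp q hq h.1 h.2
  · exact key q hq p hp h.1 h.2

/-- A cap that meets both parts has only one point in the lower part. -/
lemma IsCap.card_inter_le_one {T L R : Finset (ℤ × ℤ)} (hT : IsCap T) (hLR : LeftOf L R)
    (hRL : HighAbove R L) (hR : (T ∩ R).Nonempty) : (T ∩ L).card ≤ 1 := by
  obtain ⟨a, ha⟩ := hR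
  rw [Finset.mem_inter] at ha
  have key : ∀ p ∈ T ∩ L, ∀ q ∈ T ∩ L, p.1 < q.1 → 0 < orient p q a → False := by
    intro p hp q hq hpq h
    rw [Finset.mem_inter] at hp hq
    have := hT p hp.1 q hq.1 a ha.1 hpq (hLR q hq.2 a ha.2)
    omega
  refine Finset.card_le_one.2 fun p hp q hq => ?_
  by_contra hne
  rcases hRL.2 p (Finset.mem_inter.1 hp).2 q (Finset.mem_inter.1 hq).2 hne a ha.2 with h | h
  · exact key p hp q hq h.1 h.2
  · exact key q hq p hp h.1 h.2

lemma inter_union_of_subset {T L R : Finset (ℤ × ℤ)} (h : T ⊆ L ∪ R) :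
    T = T ∩ L ∪ T ∩ R := by
  rw [← Finset.inter_union_distrib_left, Finset.inter_eq_left.2 h]

lemma card_le_inter_add_inter {T L R : Finset (ℤ × ℤ)} (h : T ⊆ L ∪ R) :
    T.card ≤ (T ∩ L).card + (T ∩ R).card := by
  conv_lhs => rw [inter_union_of_subset h]
  exact Finset.card_union_le _ _

/-! ### The combinatorics of a single block -/

/-- `IsBlock k l X` says that `X` is built like `S_{k,l}`, with arbitrary displacements at every
use of the recursion. -/
inductive IsBlock : ℕ → ℕ → Finset (ℤ × ℤ) → Prop
  | single (k l : ℕ) (p : ℤ × ℤ) (hk : 2 ≤ k) (hl : 2 ≤ l) (h : k = 2 ∨ l = 2) : IsBlock k l {p}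
  | union (k l : ℕ) (L R : Finset (ℤ × ℤ)) (hk : 2 ≤ k) (hl : 2 ≤ l) (hL : IsBlock k (l + 1) L)
      (hR : IsBlock (k + 1) l R) (hLR : LeftOf L R) (hRL : HighAbove R L) :
      IsBlock (k + 1) (l + 1) (L ∪ R)

lemma IsBlock.card_eq {k l : ℕ} {X : Finset (ℤ × ℤ)} (h : IsBlock k l X) :
    X.card = (k + l - 4).choose (k - 2) := by
  induction h with
  | single k l p hk hl h =>
    rcases h with rfl | rfl
    · simp
    · simp
  | union k l L R hk hl _ _ hLR _ ihL ihR =>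
    have hd : Disjoint L R := Finset.disjoint_left.2 fun p hp hp' => (hLR p hp p hp').false
    obtain ⟨k, rfl⟩ := Nat.exists_eq_add_of_le hk
    obtain ⟨l, rfl⟩ := Nat.exists_eq_add_of_le hl
    rw [Finset.card_union_of_disjoint hd, ihL, ihR]
    have e1 : 2 + k + (2 + l + 1) - 4 = k + l + 1 := by omega
    have e2 : 2 + k + 1 + (2 + l) - 4 = k + l + 1 := by omega
    have e3 : 2 + k + 1 + (2 + l + 1) - 4 = k + l + 1 + 1 := by omega
    have e4 : 2 + k + 1 - 2 = k + 1 := by omega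
    have e5 : 2 + k - 2 = k := by omega
    rw [e1, e2, e3, e4, e5]
    exact (Nat.choose_succ_succ _ _).symm

lemma IsBlock.card_le_of_isCup {k l : ℕ} {X : Finset (ℤ × ℤ)} (h : IsBlock k l X) :
    ∀ T ⊆ X, IsCup T → T.card ≤ k - 1 := by
  induction h with
  | single k l p hk hl h =>
    intro T hT _
    have := Finset.card_le_card hT
    rw [Finset.card_singleton] at this
    omega
  | union k l L R hk hl _ _ hLR hRL ihL ihR =>
    intro T hT hcup
    have hc := card_le_inter_add_inter hT
    have h1 := ihL _ Finset.inter_subset_right (hcup.subset Finset.inter_subset_left)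
    have h2 := ihR _ Finset.inter_subset_right (hcup.subset Finset.inter_subset_left)
    rcases (T ∩ L).eq_empty_or_nonempty with h | h
    · rw [h, Finset.card_empty] at hc
      omega
    · have := hcup.card_inter_le_one hLR hRL h
      omega

lemma IsBlock.card_le_of_isCap {k l : ℕ} {X : Finset (ℤ × ℤ)} (h : IsBlock k l X) :
    ∀ T ⊆ X, IsCap T → T.card ≤ l - 1 := by
  induction h with
  | single k l p hk hl h =>
    intro T hT _
    have := Finset.card_le_card hT
    rw [Finset.card_singleton] at this
    omega
  | union k l L R hk hl _ _ hLR hRL ihL ihR =>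
    intro T hT hcap
    have hc := card_le_inter_add_inter hT
    have h1 := ihL _ Finset.inter_subset_right (hcap.subset Finset.inter_subset_left)
    have h2 := ihR _ Finset.inter_subset_right (hcap.subset Finset.inter_subset_left)
    rcases (T ∩ R).eq_empty_or_nonempty with h | h
    · rw [h, Finset.card_empty] at hc
      omega
    · have := hcap.card_inter_le_one hLR hRL h
      omega

/-- A convex polygon in a block that meets both parts consists of a cup in the lower part and a cap
in the upper part. -/
lemma IsBlock.card_le_of_isConvexPolygon {k l : ℕ} {X : Finset (ℤ × ℤ)} (h : IsBlock k l X) :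
    ∀ T ⊆ X, IsConvexPolygon T → T.card ≤ k + l - 3 := by
  induction h with
  | single k l p hk hl h =>
    intro T hT _
    have := Finset.card_le_card hT
    rw [Finset.card_singleton] at this
    omega
  | union k l L R hk hl hL hR hLR hRL ihL ihR =>
    intro T hT hconv
    have hc := card_le_inter_add_inter hT
    rcases (T ∩ L).eq_empty_or_nonempty with h | h
    · have := ihR _ Finset.inter_subset_right (hconv.subset Finset.inter_subset_left)
      rw [h, Finset.card_empty] at hc
      omega
    rcases (T ∩ R).eq_empty_or_nonempty with h' | h'
    · have := ihL _ Finset.inter_subset_right (hconv.subset Finset.inter_subset_left)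
      rw [h', Finset.card_empty] at hc
      omega
    have h1 := hL.card_le_of_isCup _ Finset.inter_subset_right (hconv.isCup_inter hRL h')
    have h2 := hR.card_le_of_isCap _ Finset.inter_subset_right (hconv.isCap_inter hRL h)
    omega

/-- Two points on one side of `HighAbove` and one on the other are never collinear. -/
lemma HighAbove.orient_ne_zero {X Y : Finset (ℤ × ℤ)} (h : HighAbove X Y) {a b c : ℤ × ℤ}
    (hab : a ≠ b) (hc : (a ∈ X ∧ b ∈ X ∧ c ∈ Y) ∨ (a ∈ Y ∧ b ∈ Y ∧ c ∈ X)) :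
    orient a b c ≠ 0 := by
  rcases hc with ⟨ha, hb, hc⟩ | ⟨ha, hb, hc⟩
  · exact (h.1 a ha b hb hab c hc).orient_ne_zero
  · exact (h.2 a ha b hb hab c hc).orient_ne_zero

lemma IsBlock.orient_ne_zero {k l : ℕ} {X : Finset (ℤ × ℤ)} (h : IsBlock k l X) :
    ∀ a ∈ X, ∀ b ∈ X, ∀ c ∈ X, a ≠ b → a ≠ c → b ≠ c → orient a b c ≠ 0 := by
  induction h with
  | single k l p hk hl h =>
    intro a ha b hb c _ hab
    rw [Finset.mem_singleton] at ha hb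
    exact absurd (ha.trans hb.symm) hab
  | union k l L R hk hl _ _ hLR hRL ihL ihR =>
    intro a ha b hb c hc hab hac hbc
    rw [Finset.mem_union] at ha hb hc
    rcases ha with ha | ha <;> rcases hb with hb | hb <;> rcases hc with hc | hc
    · exact ihL a ha b hb c hc hab hac hbc
    · exact hRL.orient_ne_zero hab (Or.inr ⟨ha, hb, hc⟩)
    · rw [orient_rotate c a b]
      exact hRL.orient_ne_zero hac.symm (Or.inr ⟨hc, ha, hb⟩)
    · rw [← orient_rotate a b c]
      exact hRL.orient_ne_zero hbc (Or.inl ⟨hb, hc, ha⟩)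
    · rw [← orient_rotate a b c]
      exact hRL.orient_ne_zero hbc (Or.inr ⟨hb, hc, ha⟩)
    · rw [orient_rotate c a b]
      exact hRL.orient_ne_zero hac.symm (Or.inl ⟨hc, ha, hb⟩)
    · exact hRL.orient_ne_zero hab (Or.inl ⟨ha, hb, hc⟩)
    · exact ihR a ha b hb c hc hab hac hbc

/-! ### Translates of the sets `S_{k,l}` are blocks -/

lemma mem_translate {v p : ℤ × ℤ} {X : Finset (ℤ × ℤ)} :
    p ∈ translate v X ↔ ∃ q ∈ X, (q.1 + v.1, q.2 + v.2) = p := by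
  simp [translate]

lemma translate_union (v : ℤ × ℤ) (X Y : Finset (ℤ × ℤ)) :
    translate v (X ∪ Y) = translate v X ∪ translate v Y :=
  Finset.image_union _ _

lemma translate_translate (v w : ℤ × ℤ) (X : Finset (ℤ × ℤ)) :
    translate v (translate w X) = translate (v + w) X := by
  unfold translate
  rw [Finset.image_image]
  congr 1
  funext p
  simp only [Function.comp, Prod.fst_add, Prod.snd_add]
  ext <;> simp <;> ring

lemma translate_mono (v : ℤ × ℤ) {X Y : Finset (ℤ × ℤ)} (h : X ⊆ Y) :
    translate v X ⊆ translate v Y :=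
  Finset.image_subset_image h

lemma orient_translate (v p q a : ℤ × ℤ) :
    orient (p.1 + v.1, p.2 + v.2) (q.1 + v.1, q.2 + v.2) (a.1 + v.1, a.2 + v.2)
      = orient p q a := by
  unfold orient; ring

lemma LeftOf.translate {X Y : Finset (ℤ × ℤ)} (h : LeftOf X Y) (v : ℤ × ℤ) :
    LeftOf (translate v X) (translate v Y) := by
  intro p' hp' q' hq'
  obtain ⟨p, hp, rfl⟩ := mem_translate.1 hp'
  obtain ⟨q, hq, rfl⟩ := mem_translate.1 hq'
  simpa using h p hp q hq

lemma HighAbove.translate {X Y : Finset (ℤ × ℤ)} (h : HighAbove X Y) (v : ℤ × ℤ) :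
    HighAbove (translate v X) (translate v Y) := by
  constructor
  all_goals
    intro p' hp' q' hq' hpq a' ha'
    obtain ⟨p, hp, rfl⟩ := mem_translate.1 hp'
    obtain ⟨q, hq, rfl⟩ := mem_translate.1 hq'
    obtain ⟨a, ha, rfl⟩ := mem_translate.1 ha'
    have hne : p ≠ q := fun e => hpq (by rw [e])
  · simpa [LineAbove, orient_translate] using h.1 p hp q hq hne a ha
  · simpa [LineBelow, orient_translate] using h.2 p hp q hq hne a ha

lemma Admissible.isBlock {δ δ' : ℕ → ℕ → ℤ} (h : Admissible δ δ') (k l : ℕ) (hk : 2 ≤ k)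
    (hl : 2 ≤ l) (v : ℤ × ℤ) : IsBlock k l (translate v (cupCapSet δ δ' k l)) := by
  induction hn : k + l using Nat.strong_induction_on generalizing k l v with
  | _ n ih =>
    rw [cupCapSet]
    split_ifs with h2
    · have : ErdosSzekeres.translate v {(0, 0)} = {v} := by simp [ErdosSzekeres.translate]
      rw [this]
      exact .single k l v hk hl (by omega)
    · push Not at h2
      obtain ⟨k, rfl⟩ : ∃ k', k = k' + 1 := ⟨k - 1, by omega⟩
      obtain ⟨l, rfl⟩ : ∃ l', l = l' + 1 := ⟨l - 1, by omega⟩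
      obtain ⟨h3, h4⟩ := h (k + 1) (l + 1) (by omega) (by omega)
      simp only [Nat.add_sub_cancel] at h3 h4 ⊢
      rw [translate_union]
      refine .union k l _ _ (by omega) (by omega) (ih _ ?_ k (l + 1) (by omega) (by omega) v rfl)
        ?_ (h3.translate v) (h4.translate v)
      · omega
      · rw [translate_translate]
        exact ih _ (by omega) (k + 1) l (by omega) (by omega) _ rfl

/-! ### The combinatorics of the union of the blocks -/

/-- The arrangement of the blocks in the construction, separated from how their points are
obtained. -/
structure IsArrangement (t : ℕ) (B : ℕ → Finset (ℤ × ℤ)) : Prop where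
  isBlock : ∀ i, i ≤ t - 2 → IsBlock (t - i) (i + 2) (B i)
  leftOf : ∀ i j, i < j → j ≤ t - 2 → LeftOf (B i) (B j)
  highAbove : ∀ i j, i < j → j ≤ t - 2 → HighAbove (B i) (B j)
  rightTurn : ∀ i j k, i < j → j < k → k ≤ t - 2 →
    ∀ a ∈ B i, ∀ b ∈ B j, ∀ c ∈ B k, orient a b c < 0

lemma IsErdosSzekeresConstruction.exists_isArrangement {t : ℕ} (ht : 2 ≤ t) {S : Finset (ℤ × ℤ)}
    (h : IsErdosSzekeresConstruction t S) :
    ∃ B, IsArrangement t B ∧ S = (Finset.range (t - 1)).biUnion B := by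
  obtain ⟨δ, δ', q, B, hadm, hB, hS, hpair, htriple⟩ := h
  refine ⟨B, ⟨fun i hi => ?_, fun i j h1 h2 => (hpair i j h1 h2).1,
    fun i j h1 h2 => (hpair i j h1 h2).2, htriple⟩, hS⟩
  rw [hB i hi]
  exact hadm.isBlock _ _ (by omega) (by omega) _

lemma IsArrangement.card_biUnion {t : ℕ} (ht : 2 ≤ t) {B : ℕ → Finset (ℤ × ℤ)}
    (h : IsArrangement t B) : ((Finset.range (t - 1)).biUnion B).card = 2 ^ (t - 2) := by
  have hlt : ∀ i j, i < j → j ≤ t - 2 → Disjoint (B i) (B j) := fun i j hij hj =>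
    Finset.disjoint_left.2 fun p hp hp' => (h.leftOf i j hij hj p hp p hp').false
  rw [Finset.card_biUnion]
  · rw [← Nat.sum_range_choose, show t - 2 + 1 = t - 1 by omega]
    refine Finset.sum_congr rfl fun i hi => ?_
    rw [Finset.mem_range] at hi
    rw [(h.isBlock i (by omega)).card_eq, show t - i + (i + 2) - 4 = t - 2 by omega,
      show t - i - 2 = t - 2 - i by omega, Nat.choose_symm (by omega)]
  · intro i hi j hj hij
    rw [Finset.mem_coe, Finset.mem_range] at hi hj
    rcases lt_or_gt_of_ne hij with hlt' | hlt'
    · exact hlt i j hlt' (by omega)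
    · exact (hlt j i hlt' (by omega)).symm

lemma IsArrangement.generalPosition {t : ℕ} {B : ℕ → Finset (ℤ × ℤ)}
    (h : IsArrangement t B) : GeneralPosition ((Finset.range (t - 1)).biUnion B) := by
  have two : ∀ i j, i ≤ t - 2 → j ≤ t - 2 → i ≠ j → ∀ a ∈ B i, ∀ b ∈ B i, ∀ c ∈ B j, a ≠ b →
      orient a b c ≠ 0 := by
    intro i j hi hj hij a ha b hb c hc hab
    rcases lt_or_gt_of_ne hij with hlt | hlt
    · exact (h.highAbove i j hlt hj).orient_ne_zero hab (Or.inl ⟨ha, hb, hc⟩)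
    · exact (h.highAbove j i hlt hi).orient_ne_zero hab (Or.inr ⟨ha, hb, hc⟩)
  intro a ha b hb c hc hab hac hbc hcol
  have h0 := orient_eq_zero_of_collinear hcol
  have h1 : orient b c a = 0 := by rw [orient_rotate, h0]
  have h2 : orient c a b = 0 := by rw [← orient_rotate c a b, h0]
  have h3 : orient b a c = 0 := by rw [orient_swap, h0, neg_zero]
  have h4 : orient c b a = 0 := by rw [orient_swap, h1, neg_zero]
  have h5 : orient a c b = 0 := by rw [orient_swap, h2, neg_zero]
  simp only [Finset.mem_biUnion, Finset.mem_range] at ha hb hc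
  obtain ⟨i, hi, ha⟩ := ha
  obtain ⟨j, hj, hb⟩ := hb
  obtain ⟨k, hk, hc⟩ := hc
  have hi' : i ≤ t - 2 := by omega
  have hj' : j ≤ t - 2 := by omega
  have hk' : k ≤ t - 2 := by omega
  by_cases hij : i = j
  · subst hij
    by_cases hik : i = k
    · subst hik
      exact (h.isBlock i hi').orient_ne_zero a ha b hb c hc hab hac hbc h0
    · exact two i k hi' hk' hik a ha b hb c hc hab h0
  by_cases hik : i = k
  · subst hik
    exact two i j hi' hj' hij c hc a ha b hb hac.symm h2
  by_cases hjk : j = k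
  · subst hjk
    exact two j i hj' hi' (Ne.symm hij) b hb c hc a ha hbc h1
  rcases lt_or_gt_of_ne hij with u | u <;> rcases lt_or_gt_of_ne hik with v | v <;>
    rcases lt_or_gt_of_ne hjk with w | w
  · exact (h.rightTurn i j k u w hk' a ha b hb c hc).ne h0
  · exact (h.rightTurn i k j v w hj' a ha c hc b hb).ne h5
  · omega
  · exact (h.rightTurn k i j v u hj' c hc a ha b hb).ne h2
  · exact (h.rightTurn j i k u v hk' b hb a ha c hc).ne h3
  · omega
  · exact (h.rightTurn j k i w v hi' b hb c hc a ha).ne h1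
  · exact (h.rightTurn k j i w u hi' c hc b hb a ha).ne h4

/-- A block lying between two other blocks that a convex polygon meets contains at most one vertex
of that polygon. -/
lemma IsArrangement.card_inter_le_one {t : ℕ} {B : ℕ → Finset (ℤ × ℤ)} (h : IsArrangement t B)
    {T : Finset (ℤ × ℤ)} (hT : IsConvexPolygon T) {i j k : ℕ} (hij : i < j) (hjk : j < k)
    (hk : k ≤ t - 2) (hi : (T ∩ B i).Nonempty) (hk' : (T ∩ B k).Nonempty) :
    (T ∩ B j).card ≤ 1 := by
  obtain ⟨a, ha⟩ := hi
  obtain ⟨c, hc⟩ := hk'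
  rw [Finset.mem_inter] at ha hc
  -- the left one of two such vertices lies in the triangle spanned by `a`, `c` and the right one
  have key : ∀ p ∈ T ∩ B j, ∀ q ∈ T ∩ B j, p.1 < q.1 → False := by
    intro p hp q hq hpq
    rw [Finset.mem_inter] at hp hq
    have hne : p ≠ q := fun e => by simp [e] at hpq
    have h1 := ((h.highAbove i j hij (by omega)).2 p hp.2 q hq.2 hne a ha.2).orient_pos hpq
    have h2 := ((h.highAbove j k hjk hk).1 p hp.2 q hq.2 hne c hc.2).orient_neg hpq
    have h3 := h.rightTurn i j k hij hjk hk a ha.2 p hp.2 c hc.2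
    have h4 := h.rightTurn i j k hij hjk hk a ha.2 q hq.2 c hc.2
    have hpa : p ≠ a := by rintro rfl; simp [orient] at h1
    have hpc : p ≠ c := by rintro rfl; simp [orient] at h2
    have := hT.not_mem_triangle ha.1 hc.1 hq.1 hp.1 hpa hpc hne
      (by unfold orient at *; linarith) (by unfold orient at *; linarith)
      (by unfold orient at *; linarith)
    unfold orient at *
    linarith
  refine Finset.card_le_one.2 fun p hp q hq => ?_
  by_contra hne
  rcases (h.highAbove i j hij (by omega)).2 p (Finset.mem_inter.1 hp).2 q (Finset.mem_inter.1 hq).2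
    hne a ha.2 with h' | h'
  · exact key p hp q hq h'.1
  · exact key q hq p hp h'.1

/-- A convex polygon meeting several blocks has a cap in the first block it meets, a cup in the
last one, and at most one vertex in each block between. -/
lemma IsArrangement.card_le_of_isConvexPolygon {t : ℕ} (ht : 2 ≤ t) {B : ℕ → Finset (ℤ × ℤ)}
    (h : IsArrangement t B) {T : Finset (ℤ × ℤ)} (hTS : T ⊆ (Finset.range (t - 1)).biUnion B)
    (hT : IsConvexPolygon T) : T.card ≤ t - 1 := by
  classical
  set I := (Finset.range (t - 1)).filter fun i => (T ∩ B i).Nonempty with hI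
  have memI : ∀ {i}, i ∈ I ↔ i < t - 1 ∧ (T ∩ B i).Nonempty := by simp [hI]
  have hcover : T ⊆ I.biUnion fun i => T ∩ B i := by
    intro p hp
    obtain ⟨i, hi, hpi⟩ := Finset.mem_biUnion.1 (hTS hp)
    have hp' : p ∈ T ∩ B i := Finset.mem_inter.2 ⟨hp, hpi⟩
    exact Finset.mem_biUnion.2 ⟨i, memI.2 ⟨Finset.mem_range.1 hi, p, hp'⟩, hp'⟩
  have hcard : T.card ≤ ∑ i ∈ I, (T ∩ B i).card :=
    (Finset.card_le_card hcover).trans Finset.card_biUnion_le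
  rcases I.eq_empty_or_nonempty with hemp | hne
  · rw [hemp, Finset.sum_empty] at hcard
    omega
  set i := I.min' hne
  set j := I.max' hne
  obtain ⟨hi, hiT⟩ := memI.1 (I.min'_mem hne)
  obtain ⟨hj, hjT⟩ := memI.1 (I.max'_mem hne)
  have hij : i ≤ j := I.min'_le _ (I.max'_mem hne)
  have hsub : I ⊆ Finset.Icc i j := fun x hx =>
    Finset.mem_Icc.2 ⟨I.min'_le x hx, I.le_max' x hx⟩
  have hcard' := hcard.trans (Finset.sum_le_sum_of_subset hsub)
  rcases hij.eq_or_lt with e | hlt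
  · rw [← e, Finset.Icc_self, Finset.sum_singleton] at hcard'
    have := (h.isBlock i (by omega)).card_le_of_isConvexPolygon _ Finset.inter_subset_right
      (hT.subset (Finset.inter_subset_left (s₂ := B i)))
    omega
  · have hHA := h.highAbove i j hlt (by omega)
    have h1 := (h.isBlock i (by omega)).card_le_of_isCap _ Finset.inter_subset_right
      (hT.isCap_inter hHA hjT)
    have h2 := (h.isBlock j (by omega)).card_le_of_isCup _ Finset.inter_subset_right
      (hT.isCup_inter hHA hiT)
    have h3 : ∑ m ∈ Finset.Ioo i j, (T ∩ B m).card ≤ j - i - 1 := by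
      refine (Finset.sum_le_card_nsmul _ _ 1 fun m hm => ?_).trans (by simp)
      rw [Finset.mem_Ioo] at hm
      exact h.card_inter_le_one hT hm.1 hm.2 (by omega) hiT hjT
    rw [← Finset.Ioc_insert_left hlt.le, Finset.sum_insert (by simp),
      ← Finset.Ioo_insert_right hlt, Finset.sum_insert (by simp)] at hcard'
    omega

/-! ### The displacements -/

/-- The displacement `(4 ^ M, M 4 ^ M)` used for `S_{k,l}` with `k + l = M + 6`. When `k + l`
grows by one, its width grows by a factor of four and its slope by one. -/
def step (M : ℕ) : ℤ × ℤ := (4 ^ M, M * 4 ^ M)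

/-- All sums of subsets of `{step 0, …, step (M - 1)}`. -/
def stepSums : ℕ → Finset (ℤ × ℤ)
  | 0 => {(0, 0)}
  | M + 1 => stepSums M ∪ translate (step M) (stepSums M)

lemma zero_mem_stepSums (M : ℕ) : ((0, 0) : ℤ × ℤ) ∈ stepSums M := by
  induction M with
  | zero => simp [stepSums]
  | succ M ih => exact Finset.mem_union_left _ ih

lemma mem_stepSums_succ {M : ℕ} {p : ℤ × ℤ} :
    p ∈ stepSums (M + 1) ↔
      p ∈ stepSums M ∨ ∃ q ∈ stepSums M, (q.1 + 4 ^ M, q.2 + M * 4 ^ M) = p := by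
  rw [stepSums, Finset.mem_union, mem_translate]
  rfl

/-- The differences of points of `stepSums M` are small compared with `4 ^ M`, horizontally and in
the direction transversal to slope `M - 1/3`. The slope `M - 1/3` is the one that separates the lines
inside `stepSums M` from the lines joining it to its translate by `step M`. -/
lemma stepSums_sub_bounds (M : ℕ) : ∀ p ∈ stepSums M, ∀ q ∈ stepSums M,
    3 * |q.1 - p.1| < 4 ^ M ∧ |(3 * M - 1) * (q.1 - p.1) - 3 * (q.2 - p.2)| < 4 ^ M := by
  induction M with
  | zero =>
    intro p hp q hq
    simp only [stepSums, Finset.mem_singleton] at hp hq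
    subst hp hq
    simp
  | succ M ih =>
    have h4 : (0 : ℤ) < 4 ^ M := by positivity
    intro p hp q hq
    rw [mem_stepSums_succ] at hp hq
    rw [pow_succ]
    push_cast
    rcases hp with hp | ⟨p, hp, rfl⟩ <;> rcases hq with hq | ⟨q, hq, rfl⟩ <;>
    · obtain ⟨h1, h2⟩ := ih p hp q hq
      have h3 : 3 * (q.1 - p.1) < 4 ^ M := by linarith [le_abs_self (q.1 - p.1)]
      have h4 : -4 ^ M < 3 * (q.1 - p.1) := by linarith [neg_abs_le (q.1 - p.1)]
      obtain ⟨h5, h6⟩ := abs_lt.1 h2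
      constructor
      · rw [← abs_of_pos (show (0 : ℤ) < 3 by norm_num), ← abs_mul, abs_lt]
        constructor <;> linarith
      · rw [abs_lt]
        constructor <;> linarith

/-- The lines spanned by `stepSums M` have slopes between `-1` and `M - 1/3`. -/
lemma stepSums_slope (M : ℕ) : ∀ p ∈ stepSums M, ∀ q ∈ stepSums M, p ≠ q →
    p.1 ≠ q.1 ∧ (p.1 < q.1 → -(q.1 - p.1) ≤ q.2 - p.2 ∧
      3 * (q.2 - p.2) ≤ (3 * M - 1) * (q.1 - p.1)) := by
  induction M with
  | zero =>
    intro p hp q hq hne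
    simp only [stepSums, Finset.mem_singleton] at hp hq
    exact absurd (hp.trans hq.symm) hne
  | succ M ih =>
    have h4 : (0 : ℤ) < 4 ^ M := by positivity
    have hM : (0 : ℤ) ≤ M := by positivity
    have cross : ∀ p ∈ stepSums M, ∀ q ∈ stepSums M, p.1 < q.1 + 4 ^ M ∧
        -(q.1 + 4 ^ M - p.1) ≤ q.2 + M * 4 ^ M - p.2 ∧
        3 * (q.2 + M * 4 ^ M - p.2) ≤ (3 * (M + 1) - 1) * (q.1 + 4 ^ M - p.1) := by
      intro p hp q hq
      obtain ⟨h1, h2⟩ := stepSums_sub_bounds M p hp q hq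
      have h3 : 3 * (q.1 - p.1) < 4 ^ M := by linarith [le_abs_self (q.1 - p.1)]
      have h5 : -4 ^ M < 3 * (q.1 - p.1) := by linarith [neg_abs_le (q.1 - p.1)]
      obtain ⟨h6, h7⟩ := abs_lt.1 h2
      have hpos : 0 < q.1 + 4 ^ M - p.1 := by linarith
      have := mul_nonneg hM hpos.le
      refine ⟨by linarith, ?_, ?_⟩ <;> linarith
    have inner : ∀ p ∈ stepSums M, ∀ q ∈ stepSums M, p ≠ q → p.1 ≠ q.1 ∧ (p.1 < q.1 →
        -(q.1 - p.1) ≤ q.2 - p.2 ∧ 3 * (q.2 - p.2) ≤ (3 * (M + 1) - 1) * (q.1 - p.1)) := by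
      intro p hp q hq hne
      obtain ⟨h1, h2⟩ := ih p hp q hq hne
      refine ⟨h1, fun h => ⟨(h2 h).1, ?_⟩⟩
      linarith [(h2 h).2]
    intro p hp q hq hne
    rw [mem_stepSums_succ] at hp hq
    push_cast
    rcases hp with hp | ⟨p, hp, rfl⟩ <;> rcases hq with hq | ⟨q, hq, rfl⟩
    · exact inner p hp q hq hne
    · exact ⟨(cross p hp q hq).1.ne, fun _ => (cross p hp q hq).2⟩
    · have := (cross q hq p hp).1
      exact ⟨this.ne', fun h => absurd h this.not_gt⟩
    · obtain ⟨h1, h2⟩ := inner p hp q hq fun e => hne (by rw [e])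
      refine ⟨by simpa using h1, fun h => ?_⟩
      simpa using h2 (by simpa using h)

/-- `stepSums M` lies to the left of its translate by `step M`, and the lines joining a point of the
former to a point of the latter have slope greater than `M - 1/3`. -/
lemma stepSums_cross (M : ℕ) {p q : ℤ × ℤ} (hp : p ∈ stepSums M)
    (hqT : q ∈ translate (step M) (stepSums M)) :
    p.1 < q.1 ∧ (3 * M - 1) * (q.1 - p.1) < 3 * (q.2 - p.2) := by
  obtain ⟨q, hq, rfl⟩ := mem_translate.1 hqT
  obtain ⟨h1, h2⟩ := stepSums_sub_bounds M p hp q hq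
  have h4 : (0 : ℤ) < 4 ^ M := by positivity
  have h5 : -4 ^ M < 3 * (q.1 - p.1) := by linarith [neg_abs_le (q.1 - p.1)]
  obtain ⟨h6, h7⟩ := abs_lt.1 h2
  simp only [step]
  constructor <;> linarith

/-- If the lines inside `X` and inside `Y` have slope at most `c / 3`, and the lines from `Y`
rightwards to `X` have larger slope, then `X` is high above `Y`. -/
lemma highAbove_of_slope_lt {X Y : Finset (ℤ × ℤ)} (c : ℤ)
    (hX : ∀ p ∈ X, ∀ q ∈ X, p ≠ q → p.1 ≠ q.1 ∧
      (p.1 < q.1 → 3 * (q.2 - p.2) ≤ c * (q.1 - p.1)))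
    (hY : ∀ p ∈ Y, ∀ q ∈ Y, p ≠ q → p.1 ≠ q.1 ∧
      (p.1 < q.1 → 3 * (q.2 - p.2) ≤ c * (q.1 - p.1)))
    (hYX : ∀ p ∈ Y, ∀ q ∈ X, p.1 < q.1 ∧ c * (q.1 - p.1) < 3 * (q.2 - p.2)) :
    HighAbove X Y := by
  have up : ∀ p ∈ X, ∀ q ∈ X, p ≠ q → ∀ a ∈ Y, p.1 < q.1 → orient p q a < 0 := by
    intro p hp q hq hne a ha h
    have h1 := (hX p hp q hq hne).2 h
    obtain ⟨h2, h3⟩ := hYX a ha p hp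
    have := mul_lt_mul_of_pos_left h3 (sub_pos.2 h)
    have := mul_le_mul_of_nonneg_right h1 (sub_pos.2 h2).le
    unfold orient
    linarith
  have down : ∀ p ∈ Y, ∀ q ∈ Y, p ≠ q → ∀ a ∈ X, p.1 < q.1 → 0 < orient p q a := by
    intro p hp q hq hne a ha h
    have h1 := (hY p hp q hq hne).2 h
    obtain ⟨h2, h3⟩ := hYX p hp a ha
    have := mul_lt_mul_of_pos_left h3 (sub_pos.2 h)
    have := mul_le_mul_of_nonneg_right h1 (sub_pos.2 h2).le
    unfold orient
    linarith
  constructor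
  · intro p hp q hq hne a ha
    rcases lt_or_gt_of_ne (hX p hp q hq hne).1 with h | h
    · exact Or.inl ⟨h, up p hp q hq hne a ha h⟩
    · exact Or.inr ⟨h, up q hq p hp hne.symm a ha h⟩
  · intro p hp q hq hne a ha
    rcases lt_or_gt_of_ne (hY p hp q hq hne).1 with h | h
    · exact Or.inl ⟨h, down p hp q hq hne a ha h⟩
    · exact Or.inr ⟨h, down q hq p hp hne.symm a ha h⟩

/-- The abscissae `δ_{k,l}` of the displacements. -/
def dispX (k l : ℕ) : ℤ := (step (k + l - 6)).1

/-- The ordinates `δ'_{k,l}` of the displacements. -/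
def dispY (k l : ℕ) : ℤ := (step (k + l - 6)).2

lemma cupCapSet_subset_stepSums (k l : ℕ) :
    cupCapSet dispX dispY k l ⊆ stepSums (k + l - 5) := by
  induction hn : k + l using Nat.strong_induction_on generalizing k l with
  | _ n ih =>
    subst hn
    rw [cupCapSet]
    split_ifs with h2
    · simpa using zero_mem_stepSums _
    · push Not at h2
      have e : k + l - 5 = (k + l - 6) + 1 := by omega
      have h3 := ih _ (by omega) (k - 1) l rfl
      have h4 := ih _ (by omega) k (l - 1) rfl
      rw [show k - 1 + l - 5 = k + l - 6 by omega] at h3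
      rw [show k + (l - 1) - 5 = k + l - 6 by omega] at h4
      rw [e, stepSums]
      exact Finset.union_subset_union h3 (translate_mono _ h4)

lemma admissible_disp : Admissible dispX dispY := by
  intro k l hk hl
  have h3 := cupCapSet_subset_stepSums (k - 1) l
  have h4 := cupCapSet_subset_stepSums k (l - 1)
  rw [show k - 1 + l - 5 = k + l - 6 by omega] at h3
  rw [show k + (l - 1) - 5 = k + l - 6 by omega] at h4
  have h5 : translate (dispX k l, dispY k l) (cupCapSet dispX dispY k (l - 1)) ⊆
    translate (step (k + l - 6)) (stepSums (k + l - 6)) := translate_mono _ h4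
  set M := k + l - 6
  refine ⟨fun p hp q hq => (stepSums_cross M (h3 hp) (h5 hq)).1,
    highAbove_of_slope_lt (3 * M - 1) ?_ ?_ fun p hp q hq => stepSums_cross M (h3 hp) (h5 hq)⟩
  · intro p' hp' q' hq' hne
    obtain ⟨p, hp, rfl⟩ := mem_translate.1 hp'
    obtain ⟨q, hq, rfl⟩ := mem_translate.1 hq'
    obtain ⟨h6, h7⟩ := stepSums_slope M p (h4 hp) q (h4 hq) fun e => hne (by rw [e])
    refine ⟨by simpa using h6, fun h => ?_⟩
    simpa using (h7 (by simpa using h)).2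
  · intro p hp q hq hne
    obtain ⟨h6, h7⟩ := stepSums_slope M p (h3 hp) q (h3 hq) hne
    exact ⟨h6, fun h => (h7 h).2⟩

/-! ### The position of the blocks -/

/-- If the lines inside `X` and inside `Y` have slope at least `-1`, and the lines from `X`
rightwards to `Y` have smaller slope, then `X` is high above `Y`. -/
lemma highAbove_of_lt_slope {X Y : Finset (ℤ × ℤ)}
    (hX : ∀ p ∈ X, ∀ q ∈ X, p ≠ q → p.1 ≠ q.1 ∧ (p.1 < q.1 → -(q.1 - p.1) ≤ q.2 - p.2))
    (hY : ∀ p ∈ Y, ∀ q ∈ Y, p ≠ q → p.1 ≠ q.1 ∧ (p.1 < q.1 → -(q.1 - p.1) ≤ q.2 - p.2))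
    (hXY : ∀ p ∈ X, ∀ q ∈ Y, p.1 < q.1 ∧ q.2 - p.2 < -(q.1 - p.1)) :
    HighAbove X Y := by
  have up : ∀ p ∈ X, ∀ q ∈ X, p ≠ q → ∀ a ∈ Y, p.1 < q.1 → orient p q a < 0 := by
    intro p hp q hq hne a ha h
    have h1 := (hX p hp q hq hne).2 h
    obtain ⟨h2, h3⟩ := hXY p hp a ha
    have := mul_lt_mul_of_pos_left h3 (sub_pos.2 h)
    have := mul_le_mul_of_nonneg_right h1 (sub_pos.2 h2).le
    unfold orient
    linarith
  have down : ∀ p ∈ Y, ∀ q ∈ Y, p ≠ q → ∀ a ∈ X, p.1 < q.1 → 0 < orient p q a := by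
    intro p hp q hq hne a ha h
    have h1 := (hY p hp q hq hne).2 h
    obtain ⟨h2, h3⟩ := hXY a ha p hp
    have := mul_lt_mul_of_pos_left h3 (sub_pos.2 h)
    have := mul_le_mul_of_nonneg_right h1 (sub_pos.2 h2).le
    unfold orient
    linarith
  constructor
  · intro p hp q hq hne a ha
    rcases lt_or_gt_of_ne (hX p hp q hq hne).1 with h | h
    · exact Or.inl ⟨h, up p hp q hq hne a ha h⟩
    · exact Or.inr ⟨h, up q hq p hp hne.symm a ha h⟩
  · intro p hp q hq hne a ha
    rcases lt_or_gt_of_ne (hY p hp q hq hne).1 with h | h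
    · exact Or.inl ⟨h, down p hp q hq hne a ha h⟩
    · exact Or.inr ⟨h, down q hq p hp hne.symm a ha h⟩

/-- A bound on the extent of the sets out of which the blocks are cut. -/
lemma stepSums_abs_le {t : ℕ} (ht : 2 ≤ t) {p q : ℤ × ℤ} (hp : p ∈ stepSums (t - 3))
    (hq : q ∈ stepSums (t - 3)) :
    |q.1 - p.1| ≤ 4 ^ (t - 3) ∧ |q.2 - p.2| ≤ t * 4 ^ (t - 3) := by
  obtain ⟨h1, h2⟩ := stepSums_sub_bounds _ p hp q hq
  set M := t - 3
  have hMt : (M : ℤ) + 1 ≤ t := by omega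
  have h4 : (0 : ℤ) < 4 ^ M := by positivity
  have hM : (0 : ℤ) ≤ M := by positivity
  have h3 : 3 * (q.1 - p.1) < 4 ^ M := by linarith [le_abs_self (q.1 - p.1)]
  have h5 : -4 ^ M < 3 * (q.1 - p.1) := by linarith [neg_abs_le (q.1 - p.1)]
  obtain ⟨h6, h7⟩ := abs_lt.1 h2
  have h8 := mul_le_mul_of_nonneg_left h3.le hM
  have h9 := mul_le_mul_of_nonneg_left h5.le hM
  have h10 := mul_le_mul_of_nonneg_right hMt h4.le
  refine ⟨by linarith [abs_nonneg (q.1 - p.1)], ?_⟩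
  rw [abs_le]
  constructor <;> linarith

/-- The vector by which the `i`-th block is translated. The translates of the origin lie on a
parabola; they are `4 t` block widths apart horizontally, and the slope between consecutive ones
drops by `4` at each block. -/
def blockPos (t i : ℕ) : ℤ × ℤ :=
  (4 ^ (t - 3) + 4 * (t * 4 ^ (t - 3)) * i,
    8 * t ^ 2 * (t * 4 ^ (t - 3)) + t * 4 ^ (t - 3) + 1 - 8 * (t * 4 ^ (t - 3)) * i ^ 2)

/-- The `i`-th block of the construction. -/
def blockAt (t i : ℕ) : Finset (ℤ × ℤ) :=
  translate (blockPos t i) (cupCapSet dispX dispY (t - i) (i + 2))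

lemma exists_of_mem_blockAt {t i : ℕ} (ht : 2 ≤ t) (hi : i ≤ t - 2) {p : ℤ × ℤ}
    (hp : p ∈ blockAt t i) :
    ∃ q ∈ stepSums (t - 3), (q.1 + (blockPos t i).1, q.2 + (blockPos t i).2) = p := by
  have h := cupCapSet_subset_stepSums (t - i) (i + 2)
  rw [show t - i + (i + 2) - 5 = t - 3 by omega] at h
  exact mem_translate.1 (translate_mono _ h hp)

lemma blockAt_slope {t i : ℕ} (ht : 2 ≤ t) (hi : i ≤ t - 2) :
    ∀ p ∈ blockAt t i, ∀ q ∈ blockAt t i, p ≠ q →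
      p.1 ≠ q.1 ∧ (p.1 < q.1 → -(q.1 - p.1) ≤ q.2 - p.2) := by
  intro p' hp' q' hq' hne
  obtain ⟨p, hp, rfl⟩ := exists_of_mem_blockAt ht hi hp'
  obtain ⟨q, hq, rfl⟩ := exists_of_mem_blockAt ht hi hq'
  obtain ⟨h6, h7⟩ := stepSums_slope _ p hp q hq fun e => hne (by rw [e])
  refine ⟨by simpa using h6, fun h => ?_⟩
  simpa using (h7 (by simpa using h)).1

lemma blockAt_cross {t i j : ℕ} (ht : 2 ≤ t) (hij : i < j) (hj : j ≤ t - 2) {p q : ℤ × ℤ}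
    (hpB : p ∈ blockAt t i) (hqB : q ∈ blockAt t j) :
    p.1 < q.1 ∧ q.2 - p.2 < -(q.1 - p.1) := by
  obtain ⟨p, hp, rfl⟩ := exists_of_mem_blockAt ht (by omega) hpB
  obtain ⟨q, hq, rfl⟩ := exists_of_mem_blockAt ht hj hqB
  obtain ⟨h1, h2⟩ := stepSums_abs_le ht hp hq
  rw [abs_le] at h1 h2
  have hW : (0 : ℤ) < 4 ^ (t - 3) := by positivity
  simp only [blockPos]
  set W : ℤ := 4 ^ (t - 3)
  have ht' : (2 : ℤ) ≤ t := by exact_mod_cast ht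
  have hH : 2 * W ≤ t * W := mul_le_mul_of_nonneg_right ht' hW.le
  set H : ℤ := t * W
  have hu : (i : ℤ) + 1 ≤ j := by exact_mod_cast hij
  have hi0 : (0 : ℤ) ≤ i := by positivity
  have h3 : H * (i + 1) ≤ H * j := mul_le_mul_of_nonneg_left hu (by linarith)
  -- `j ^ 2 - i ^ 2 ≥ j - i` for integers `0 ≤ i < j`
  have h4 : H * (j - i) ≤ H * (j ^ 2 - i ^ 2) :=
    mul_le_mul_of_nonneg_left (by nlinarith) (by linarith)
  constructor <;> linarith

/-- Points close to three points of the parabola `y = -2 x ^ 2 / X` with abscissae `i X`, `j X`,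
`k X` form a right turn, if `H` and `W` bound the perturbations and `X` is large enough. -/
lemma parabola_right_turn {X H W m i j k e₁ f₁ e₂ f₂ : ℤ} (hX : X = 4 * H) (hH : H = m * W)
    (hWH : 2 * W ≤ H) (hHpos : 0 < H) (hi : 0 ≤ i) (hij : i + 1 ≤ j)
    (hjk : j + 1 ≤ k) (hk : k ≤ m)
    (he₁ : |e₁| ≤ W) (hf₁ : |f₁| ≤ H) (he₂ : |e₂| ≤ W) (hf₂ : |f₂| ≤ H) :
    (X * (j - i) + e₁) * (-(2 * X * (k ^ 2 - j ^ 2)) + f₂)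
      - (-(2 * X * (j ^ 2 - i ^ 2)) + f₁) * (X * (k - j) + e₂) < 0 := by
  have bound : ∀ {a b A C : ℤ}, |a| ≤ A → |b| ≤ C → a * b ≤ A * C ∧ -(A * C) ≤ a * b := by
    intro a b A C ha hb
    have h := mul_le_mul ha hb (abs_nonneg b) ((abs_nonneg a).trans ha)
    rw [← abs_mul, abs_le] at h
    exact ⟨h.2, h.1⟩
  have hu : 1 ≤ j - i := by linarith
  have hv : 1 ≤ k - j := by linarith
  have hkj : |2 * (k + j)| ≤ 4 * m := by rw [abs_le]; constructor <;> linarith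
  have hji : |2 * (j + i)| ≤ 4 * m := by rw [abs_le]; constructor <;> linarith
  have b₁ := (bound he₁ hkj).2
  have b₂ := (bound he₂ hji).1
  have b₃ := (bound he₁ hf₂).1
  have b₄ := (bound hf₁ he₂).2
  have b₅ := (abs_le.1 hf₂).2
  have b₆ := (abs_le.1 hf₁).1
  have hXpos : 0 < X := by linarith
  have c₁ := mul_le_mul_of_nonneg_left b₁ (mul_nonneg hXpos.le (by linarith : 0 ≤ k - j))
  have c₂ := mul_le_mul_of_nonneg_left b₂ (mul_nonneg hXpos.le (by linarith : 0 ≤ j - i))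
  have c₅ := mul_le_mul_of_nonneg_left b₅ (mul_nonneg hXpos.le (by linarith : 0 ≤ j - i))
  have c₆ := mul_le_mul_of_nonneg_left b₆ (mul_nonneg hXpos.le (by linarith : 0 ≤ k - j))
  -- slopes `i + j` and `j + k` up to `2 m` amplify the horizontal perturbations; `X = 4 m W`
  -- absorbs this
  have hWm : W * (4 * m) = X := by rw [hX, hH]; ring
  rw [hWm] at c₁ c₂
  have hWH' : 2 * (W * H) ≤ H * H := by
    have := mul_le_mul_of_nonneg_right hWH hHpos.le
    linarith
  have huv : 1 ≤ (j - i) * (k - j) := one_le_mul_of_one_le_of_one_le hu hv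
  have main := mul_le_mul_of_nonneg_left huv
    (mul_nonneg (mul_pos hXpos hXpos).le (by linarith : 0 ≤ k - i))
  have hs := mul_le_mul_of_nonneg_left (by linarith : 2 ≤ k - i) (mul_pos hHpos hHpos).le
  have hHH := mul_pos hHpos hHpos
  subst hX
  have expand : (4 * H * (j - i) + e₁) * (-(2 * (4 * H) * (k ^ 2 - j ^ 2)) + f₂)
      - (-(2 * (4 * H) * (j ^ 2 - i ^ 2)) + f₁) * (4 * H * (k - j) + e₂)
      = -2 * (4 * H * (4 * H) * (k - i) * ((j - i) * (k - j)))
        - 4 * H * (k - j) * (e₁ * (2 * (k + j))) + 4 * H * (j - i) * (e₂ * (2 * (j + i)))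
        + 4 * H * (j - i) * f₂ - 4 * H * (k - j) * f₁ + e₁ * f₂ - f₁ * e₂ := by ring
  rw [expand]
  linarith

lemma blockAt_right_turn {t i j k : ℕ} (ht : 2 ≤ t) (hij : i < j) (hjk : j < k) (hk : k ≤ t - 2)
    {a b c : ℤ × ℤ} (haB : a ∈ blockAt t i) (hbB : b ∈ blockAt t j) (hcB : c ∈ blockAt t k) :
    orient a b c < 0 := by
  obtain ⟨a, ha, rfl⟩ := exists_of_mem_blockAt ht (by omega) haB
  obtain ⟨b, hb, rfl⟩ := exists_of_mem_blockAt ht (by omega) hbB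
  obtain ⟨c, hc, rfl⟩ := exists_of_mem_blockAt ht hk hcB
  obtain ⟨h1, h2⟩ := stepSums_abs_le ht ha hb
  obtain ⟨h3, h4⟩ := stepSums_abs_le ht hb hc
  have hW : (0 : ℤ) < 4 ^ (t - 3) := by positivity
  have ht' : (2 : ℤ) ≤ t := by exact_mod_cast ht
  have := parabola_right_turn (X := 4 * (t * 4 ^ (t - 3))) (i := i) (j := j) (k := k) rfl rfl
    (mul_le_mul_of_nonneg_right ht' hW.le) (by positivity) (by positivity)
    (by exact_mod_cast hij) (by exact_mod_cast hjk) (by omega) h1 h2 h3 h4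
  refine lt_of_eq_of_lt ?_ this
  simp only [orient, blockPos]
  ring

/-- The union of the blocks `blockAt t i`. -/
def smallConstruction (t : ℕ) : Finset (ℤ × ℤ) :=
  (Finset.range (t - 1)).biUnion (blockAt t)

lemma isErdosSzekeresConstruction_smallConstruction {t : ℕ} (ht : 2 ≤ t) :
    IsErdosSzekeresConstruction t (smallConstruction t) := by
  refine ⟨dispX, dispY, blockPos t, blockAt t, admissible_disp, fun i _ => rfl, rfl,
    fun i j hij hj => ⟨fun p hp q hq => (blockAt_cross ht hij hj hp hq).1, ?_⟩,
    fun i j k hij hjk hk a ha b hb c hc => blockAt_right_turn ht hij hjk hk ha hb hc⟩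
  exact highAbove_of_lt_slope (blockAt_slope ht (by omega)) (blockAt_slope ht hj)
    fun p hp q hq => blockAt_cross ht hij hj hp hq

lemma liesInGrid_smallConstruction {t : ℕ} (ht : 2 ≤ t) :
    LiesInGrid (16 * t ^ 3 * 4 ^ t) (smallConstruction t) := by
  intro p' hp'
  obtain ⟨i, hi, hpi⟩ := Finset.mem_biUnion.1 hp'
  rw [Finset.mem_range] at hi
  obtain ⟨p, hp, rfl⟩ := exists_of_mem_blockAt ht (by omega) hpi
  have hx : 3 * |p.1| < 4 ^ (t - 3) := by
    simpa using (stepSums_sub_bounds _ _ (zero_mem_stepSums _) p hp).1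
  have hy : |p.2| ≤ t * 4 ^ (t - 3) := by
    simpa using (stepSums_abs_le ht (zero_mem_stepSums _) hp).2
  have hpow : (4 : ℤ) ^ (t - 3) ≤ 4 ^ t := pow_le_pow_right₀ (by norm_num) (by omega)
  have hW : (0 : ℤ) < 4 ^ (t - 3) := by positivity
  simp only [blockPos]
  push_cast
  set W : ℤ := 4 ^ (t - 3)
  have ht' : (2 : ℤ) ≤ t := by exact_mod_cast ht
  have hit : (i : ℤ) ≤ t := by omega
  have hi0 : (0 : ℤ) ≤ i := by positivity
  have hH : 2 * W ≤ t * W := mul_le_mul_of_nonneg_right ht' hW.le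
  have hHpos : 0 < t * W := by linarith
  have hm := mul_le_mul_of_nonneg_left hpow (by positivity : (0 : ℤ) ≤ 16 * t ^ 3)
  have hx1 : 3 * p.1 < W := by linarith [le_abs_self p.1]
  have hx2 : -W < 3 * p.1 := by linarith [neg_abs_le p.1]
  obtain ⟨hy1, hy2⟩ := abs_le.1 hy
  have g1 : 0 ≤ t * W * i := mul_nonneg hHpos.le hi0
  have g2 : t * W * i ≤ t * W * t := mul_le_mul_of_nonneg_left hit hHpos.le
  have g3 : t * W * i ^ 2 ≤ t * W * t ^ 2 :=
    mul_le_mul_of_nonneg_left (pow_le_pow_left₀ hi0 hit 2) hHpos.le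
  have g4 : 0 ≤ t * W * i ^ 2 := mul_nonneg hHpos.le (by positivity)
  have g5 : t * W * 2 ≤ t * W * t := mul_le_mul_of_nonneg_left ht' hHpos.le
  have g6 : t * W * t * 2 ≤ t * W * t * t :=
    mul_le_mul_of_nonneg_left ht' (mul_nonneg hHpos.le (by linarith))
  refine ⟨?_, ?_, ?_, ?_⟩ <;> linarith

/-! ### The size of the grid -/

lemma gridSize_isBigO :
    (fun t : ℕ => ((16 * t ^ 3 * 4 ^ t : ℕ) : ℝ)) =O[atTop]
      fun t : ℕ => ((2 : ℝ) ^ (t - 2)) ^ 2 * (Real.logb 2 ((2 : ℝ) ^ (t - 2))) ^ 3 := by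
  refine IsBigO.of_bound 6912 ?_
  filter_upwards [eventually_ge_atTop 3] with t ht
  obtain ⟨s, rfl⟩ : ∃ s, t = s + 2 := ⟨t - 2, by omega⟩
  have hs : (1 : ℝ) ≤ s := by exact_mod_cast (by omega : 1 ≤ s)
  rw [Nat.add_sub_cancel, Real.logb_pow, Real.logb_self_eq_one (by norm_num), mul_one,
    Real.norm_of_nonneg (by positivity), Real.norm_of_nonneg (by positivity)]
  have h1 : ((s : ℝ) + 2) ^ 3 ≤ (3 * s) ^ 3 := pow_le_pow_left₀ (by positivity) (by linarith) 3
  have h2 : ((2 : ℝ) ^ s) ^ 2 = 4 ^ s := by rw [← pow_mul, mul_comm, pow_mul]; norm_num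
  rw [h2]
  push_cast
  have := mul_le_mul_of_nonneg_right h1 (by positivity : (0 : ℝ) ≤ 16 * 4 ^ (s + 2))
  rw [pow_add] at this ⊢
  linarith

end ErdosSzekeres

theorem mainTheorem1 :
    ∃ m : ℕ → ℕ,
      ((fun t : ℕ => (m t : ℝ)) =O[atTop]
        fun t : ℕ => ((2 : ℝ) ^ (t - 2)) ^ 2 * (Real.logb 2 ((2 : ℝ) ^ (t - 2))) ^ 3) ∧
      ∀ t : ℕ, 2 ≤ t → ∃ S : Finset (ℤ × ℤ),
        ErdosSzekeres.IsErdosSzekeresConstruction t S ∧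
        S.card = 2 ^ (t - 2) ∧
        ErdosSzekeres.GeneralPosition S ∧
        (∀ T : Finset (ℤ × ℤ), T ⊆ S → ErdosSzekeres.IsConvexPolygon T → T.card ≤ t - 1) ∧
        ErdosSzekeres.LiesInGrid (m t) S := by
  refine ⟨fun t => 16 * t ^ 3 * 4 ^ t, ErdosSzekeres.gridSize_isBigO, fun t ht => ?_⟩
  have hS := ErdosSzekeres.isErdosSzekeresConstruction_smallConstruction ht
  have hgrid := ErdosSzekeres.liesInGrid_smallConstruction ht
  refine ⟨_, hS, ?_, ?_, ?_, hgrid⟩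
  all_goals
    obtain ⟨B, hB, hSB⟩ := hS.exists_isArrangement ht
    rw [hSB]
  · exact hB.card_biUnion ht
  · exact hB.generalPosition
  · exact fun T hTS hT => hB.card_le_of_isConvexPolygon ht hTS hT
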